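/- Quantum circuits are finite sequences of arbitrary single-qubit unitary gates and $\mathrm{CNOT}$ gates (with all-to-all connectivity); they may use any finite number of ancilla qubits that are initialized to $|0\rangle$ and must be returned to $|0\rangle$. For $f:\{0,1\}^n\to\mathbb{T}=\{z\in\mathbb{C}:|z|=1\}$ define $\bar f:\{0,1\}^{n+1}\to\mathbb{T}$ by $\bar f(x,c)=f(x)^{1-2c}$ for $x\in\{0,1\}^n$, $c\in\{0,1\}$ (so $\bar f(x,0)=f(x)$ and $\bar f(x,1)=\overline{f(x)}$), and identify $\bar f$ with the $(n+1)$-qubit diagonal unitary $|x,c\rangle\mapsto\bar f(x,c)\,|x,c\rangle$. Theorem. Let $r=r(n)$ be a sequence of positive integers with $r(n)=2^{t(n)}$, where $t(n)$ is real and $t(n)=o(n/\log n)$ as $n\to\infty$. Then there is a sequence $\varepsilon(n)\to 0$, depending only on the sequence $r$, such that for every $n$ and every $f:\{0,1\}^n\to\mathbb{T}$ there exists a quantum circuit with at most $(1+\varepsilon(n))\,2^n$ $\mathrm{CNOT}$ gates that implements $\bar f^{\otimes r(n)}$ exactly. -/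

import Mathlib

open Filter Asymptotics Topology Matrix

namespace QCirc

/-- Computational basis labels of a register whose qubits are indexed by `ι`. -/
abbrev Bits (ι : Type) : Type := ι → Bool

/-- Operators on the register `ι`, written in the computational basis:
the entry at `(y, x)` is the amplitude of `y` in the image of the basis state `x`. -/
abbrev Op (ι : Type) : Type := Matrix (Bits ι) (Bits ι) ℂ

/-- Gates: an arbitrary single-qubit unitary on any qubit, and the CNOT gate on any ordered
pair of distinct qubits (all-to-all connectivity). -/
inductive Gate (ι : Type) : Type
  | single (U : Matrix.unitaryGroup Bool ℂ) (i : ι) : Gate ι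
  | cnot (control target : ι) (h : control ≠ target) : Gate ι

variable {ι : Type} [Fintype ι] [DecidableEq ι]

/-- The operator of a gate on the whole register. -/
def Gate.toOp : Gate ι → Op ι
  | .single U i => Matrix.of fun y x =>
      if ∀ j, j ≠ i → y j = x j then (U : Matrix Bool Bool ℂ) (y i) (x i) else 0
  | .cnot c t _ => Matrix.of fun y x =>
      if y = Function.update x t (xor (x t) (x c)) then 1 else 0

/-- Whether a gate is a CNOT. -/
def Gate.isCNOT {ι : Type} : Gate ι → Bool
  | .single _ _ => false
  | .cnot _ _ _ => true

/-- A circuit is a finite sequence of gates; the head of the list is applied first. -/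
abbrev Circuit (ι : Type) : Type := List (Gate ι)

/-- The operator computed by a circuit. -/
def Circuit.toOp : Circuit ι → Op ι
  | [] => 1
  | g :: C => Circuit.toOp C * g.toOp

/-- The number of CNOT gates of a circuit. -/
def Circuit.cnotCount {ι : Type} (C : Circuit ι) : ℕ := C.countP Gate.isCNOT

/-- The vector `ψ ⊗ |0…0⟩` on the register `ι` enlarged by `a` ancilla qubits. -/
def withAncillas {ι : Type} (a : ℕ) (ψ : Bits ι → ℂ) : Bits (ι ⊕ Fin a) → ℂ := fun v =>
  if ∀ k : Fin a, v (Sum.inr k) = false then ψ (fun i => v (Sum.inl i)) else 0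

/-- The circuit `C`, acting on the register `ι` and on `a` ancilla qubits that start in `|0⟩`,
implements the operator `U` exactly and resets all ancillas to `|0⟩`. -/
def Circuit.Implements {a : ℕ} (C : Circuit (ι ⊕ Fin a)) (U : Op ι) : Prop :=
  ∀ ψ : Bits ι → ℂ, Circuit.toOp C *ᵥ withAncillas a ψ = withAncillas a (U *ᵥ ψ)

/-- The diagonal operator `|x⟩ ↦ f(x)|x⟩`. -/
def diagOp (f : Bits ι → Circle) : Op ι := Matrix.diagonal fun x => (f x : ℂ)

/-- The tensor power `U^{⊗ r}`; its `k`-th factor acts on the qubits `(k, i)`. -/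
def tensorPow {ι : Type} (r : ℕ) (U : Op ι) : Op (Fin r × ι) :=
  Matrix.of fun y x => ∏ k : Fin r, U (fun i => y (k, i)) (fun i => x (k, i))

/-- `f̄(x, c) = f(x)^{1 - 2c}`, where `c` is the last of the `n + 1` bits. -/
noncomputable def bar {n : ℕ} (f : Bits (Fin n) → Circle) : Bits (Fin (n + 1)) → Circle := fun v =>
  f (fun i => v i.castSucc) ^ (1 - 2 * ((v (Fin.last n)).toNat : ℤ))

end QCirc

/-! The argument is a mass-production scheme in the manner of Uhlig. A single `f̄` is a multiplexed
`z`-rotation of its control qubit and costs `2 ^ n` CNOTs (`exists_multiplexed`).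

Two copies cost little more than one. Cut `f` along `k` input bits into slices `f_0, …, f_{L-1}`
with `L = 2 ^ k`, and put `g_0 = f_0`, `g_l = f_l / f_{l-1}`, `g_L = 1 / f_{L-1}`. The product of
`g_l` over `l ≤ i` is `f_i`, and over `l > j` it is `1 / f_j`. For inputs with slice indices `i ≤
j`, the first needs only the `g_l` with `l ≤ i`, and the second only the `g_l⁻¹` with `l > j`;
inversion is a flip of the control bit. These ranges are disjoint, so one use of each signed `g_l`,
on an input selected into ancillas, serves both copies (`prod_select`, `MassProduces.double`).

After `T` levels, `2 ^ T` copies cost `(2 ^ k + 1) ^ T * 2 ^ (n - k * T) = (1 + 2 ^ (-k)) ^ T * 2 ^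
n` for the rotations, plus the cost of selection (`massProduces_pow`). With `T = ⌈log₂ r⌉` and `k =
⌈log₂ n⌉`, the ratio `T / 2 ^ k` tends to `0`. The hypothesis on `t` gives `k * T = o(n)`, so
selection costs `2 ^ (o(n))`, which is negligible (`tendsto_overhead`). -/

namespace QCirc

/-! ### Action of circuits on basis states. -/

section Maps

variable {Q : Type} [Fintype Q] [DecidableEq Q]

/-- The circuit `C` sends the basis state `x` to `z` times the basis state `y`. -/
def Maps (C : Circuit Q) (x : Bits Q) (z : Circle) (y : Bits Q) : Prop :=
  Circuit.toOp C *ᵥ Pi.single x 1 = (z : ℂ) • Pi.single y (1 : ℂ)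

theorem Circuit.toOp_append (C D : Circuit Q) :
    Circuit.toOp (C ++ D) = Circuit.toOp D * Circuit.toOp C := by
  induction C with
  | nil => simp [Circuit.toOp]
  | cons g C ih => simp [Circuit.toOp, ih, Matrix.mul_assoc]

theorem Circuit.toOp_singleton (g : Gate Q) : Circuit.toOp [g] = g.toOp := by
  simp [Circuit.toOp]

theorem Circuit.cnotCount_append {Q : Type} (C D : Circuit Q) :
    Circuit.cnotCount (C ++ D) = C.cnotCount + D.cnotCount :=
  List.countP_append

theorem Circuit.cnotCount_single {Q : Type} (U : Matrix.unitaryGroup Bool ℂ) (i : Q) :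
    Circuit.cnotCount [Gate.single U i] = 0 := rfl

theorem Circuit.cnotCount_cnot {Q : Type} (c t : Q) (h : c ≠ t) :
    Circuit.cnotCount [Gate.cnot c t h] = 1 := rfl

theorem Maps.nil (x : Bits Q) : Maps [] x 1 x := by
  simp only [Maps, Circuit.toOp, Matrix.one_mulVec, Circle.coe_one, one_smul]

theorem Maps.append {C D : Circuit Q} {x y u : Bits Q} {z w : Circle}
    (h : Maps C x z y) (h' : Maps D y w u) : Maps (C ++ D) x (z * w) u := by
  unfold Maps at *
  rw [Circuit.toOp_append, ← Matrix.mulVec_mulVec, h, Matrix.mulVec_smul, h', smul_smul,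
    Circle.coe_mul]

theorem Maps.cnot (c t : Q) (h : c ≠ t) (x : Bits Q) :
    Maps [Gate.cnot c t h] x 1 (Function.update x t (xor (x t) (x c))) := by
  unfold Maps
  rw [Circuit.toOp_singleton]
  ext y
  simp [Gate.toOp, Pi.single_apply]

theorem single_mulVec (U : Matrix.unitaryGroup Bool ℂ) (i : Q) (x : Bits Q) :
    (Gate.single U i).toOp *ᵥ Pi.single x 1 =
      ∑ b : Bool, (U : Matrix Bool Bool ℂ) b (x i) •
        Pi.single (Function.update x i b) (1 : ℂ) := by
  ext y
  simp only [Gate.toOp, mulVec_single_one, Matrix.col_apply, Matrix.of_apply, Finset.sum_apply,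
    Pi.smul_apply, Pi.single_apply, smul_eq_mul, mul_ite, mul_one, mul_zero]
  by_cases h : ∀ j, j ≠ i → y j = x j
  · rw [if_pos h, Finset.sum_eq_single (y i)]
    · rw [if_pos]
      funext j
      by_cases hj : j = i
      · subst hj; simp
      · simp [hj, h j hj]
    · intro b _ hb
      rw [if_neg]
      rintro rfl
      simp at hb
    · simp
  · rw [if_neg h, Finset.sum_eq_zero]
    intro b _
    rw [if_neg]
    rintro rfl
    exact h fun j hj => by simp [hj]

/-- `z` or `z⁻¹`, according to a control bit. -/
noncomputable def signPow (z : Circle) (b : Bool) : Circle := if b then z⁻¹ else z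

/-- The single-qubit gate `|b⟩ ↦ p(b) |b⟩`. -/
noncomputable def phaseGate (p : Bool → Circle) : Matrix.unitaryGroup Bool ℂ :=
  ⟨Matrix.diagonal fun b => (p b : ℂ), by
    rw [Matrix.mem_unitaryGroup_iff, Matrix.star_eq_conjTranspose, Matrix.diagonal_conjTranspose,
      Matrix.diagonal_mul_diagonal, ← Matrix.diagonal_one]
    congr 1
    funext b
    simp [← Circle.coe_inv_eq_conj]⟩

theorem Maps.phase (p : Bool → Circle) (i : Q) (x : Bits Q) :
    Maps [Gate.single (phaseGate p) i] x (p (x i)) x := by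
  unfold Maps
  rw [Circuit.toOp_singleton, single_mulVec, Finset.sum_eq_single (x i)]
  · simp [phaseGate]
  · intro b _ hb
    simp [phaseGate, hb]
  · simp

/-- The Hadamard gate. -/
noncomputable def hadamard : Matrix.unitaryGroup Bool ℂ :=
  ⟨Matrix.of fun b c => (if b && c then -1 else 1) * ((√2 : ℝ) : ℂ)⁻¹, by
    have h2 : ((√2 : ℝ) : ℂ) * ((√2 : ℝ) : ℂ) = 2 := by
      rw [← Complex.ofReal_mul]; norm_num
    have h3 : ((√2 : ℝ) : ℂ)⁻¹ * ((√2 : ℝ) : ℂ)⁻¹ = 1 / 2 := by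
      rw [← mul_inv, h2]; norm_num
    rw [Matrix.mem_unitaryGroup_iff]
    ext b c
    cases b <;> cases c <;>
      (simp [Matrix.mul_apply, Matrix.star_apply, Complex.conj_ofReal, h3]; try norm_num)⟩

/-- Conjugating a diagonal circuit by Hadamards on a qubit `τ` turns the phase `(-1)^{h(x) x τ}`
into the map `x τ ↦ x τ ⊕ h(x)`. -/
theorem Maps.hadamard_conj {D : Circuit Q} {τ : Q} {h : Bits Q → Bool}
    (hh : ∀ x b, h (Function.update x τ b) = h x)
    (hD : ∀ x, Maps D x (if h x && x τ then -1 else 1) x) (x : Bits Q) :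
    Maps ([Gate.single hadamard τ] ++ (D ++ [Gate.single hadamard τ])) x 1
      (Function.update x τ (xor (x τ) (h x))) := by
  have h2 : ((√2 : ℝ) : ℂ) * ((√2 : ℝ) : ℂ) = 2 := by
    rw [← Complex.ofReal_mul]; norm_num
  have h3 : ((√2 : ℝ) : ℂ)⁻¹ * ((√2 : ℝ) : ℂ)⁻¹ = 1 / 2 := by
    rw [← mul_inv, h2]; norm_num
  unfold Maps at *
  rw [Circuit.toOp_append, Circuit.toOp_append, Circuit.toOp_singleton, ← Matrix.mulVec_mulVec,
    single_mulVec, ← Matrix.mulVec_mulVec, Matrix.mulVec_sum, Matrix.mulVec_sum]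
  simp only [Matrix.mulVec_smul, hD, single_mulVec, hh, Function.update_self,
    Function.update_idem, Fintype.sum_bool]
  ext y
  cases hx : x τ <;> cases hy : h x <;> simp [hadamard] <;>
    ring_nf <;> simp only [pow_two, h3] <;> ring

end Maps

theorem Circle.exists_sq_eq (z : Circle) : ∃ w : Circle, w * w = z := by
  refine ⟨Circle.exp (Complex.arg z / 2), ?_⟩
  rw [← Circle.exp_add, add_halves, Circle.exp_arg]

/-- The equations force `b² = z w`, so a square root on the circle suffices. This separates a phase
into a part blind to a bit and a part inverted by it. -/
theorem Circle.exists_mul_div (z w : Circle) : ∃ a b : Circle, b * a = z ∧ b / a = w := by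
  obtain ⟨b, hb⟩ := Circle.exists_sq_eq (z * w)
  refine ⟨z / b, b, by simp, ?_⟩
  rw [div_div_eq_mul_div, hb, mul_div_cancel_left]

section Signs

@[simp] theorem signPow_false (z : Circle) : signPow z false = z := rfl

@[simp] theorem signPow_true (z : Circle) : signPow z true = z⁻¹ := rfl

theorem signPow_mul (z w : Circle) (b : Bool) : signPow (z * w) b = signPow z b * signPow w b := by
  cases b <;> simp [mul_comm]

theorem signPow_signPow (z : Circle) (a b : Bool) : signPow (signPow z a) b = signPow z (xor b a) := by
  cases a <;> cases b <;> simp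

end Signs

/-! ### Multiplexed rotations, diagonal unitaries and Boolean oracles. -/

section Oracles

variable {Q : Type}

/-- `f` depends only on the qubits in `insert σ S`: fixing qubit `σ` leaves a function of `S`. -/
theorem dependsOn_update [DecidableEq Q] {β : Type} {f : Bits Q → β} {σ : Q} {S : Finset Q}
    (hf : DependsOn f (insert σ S : Finset Q)) (b : Bool) :
    DependsOn (fun x => f (Function.update x σ b)) S := by
  intro x y hxy
  refine hf fun i hi => ?_
  by_cases h : i = σ
  · subst h; simp
  · simp only [Function.update_of_ne h]
    exact hxy i (by simpa [h] using hi)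

variable [DecidableEq Q]

/-- A phase `f` on the qubits `insert σ S`, split along the value of the qubit `σ`. -/
theorem exists_split {f : Bits Q → Circle} {σ : Q} {S : Finset Q}
    (hf : DependsOn f (insert σ S : Finset Q)) :
    ∃ a b : Bits Q → Circle, DependsOn a S ∧ DependsOn b S ∧
      ∀ x, f x = b x * signPow (a x) (x σ) := by
  choose a b hab hab' using Circle.exists_mul_div
  refine ⟨fun x => a (f (Function.update x σ false)) (f (Function.update x σ true)),
    fun x => b (f (Function.update x σ false)) (f (Function.update x σ true)), ?_, ?_, ?_⟩
  · intro x y hxy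
    have h1 := dependsOn_update hf false hxy
    have h2 := dependsOn_update hf true hxy
    simp only at h1 h2 ⊢
    rw [h1, h2]
  · intro x y hxy
    have h1 := dependsOn_update hf false hxy
    have h2 := dependsOn_update hf true hxy
    simp only at h1 h2 ⊢
    rw [h1, h2]
  · intro x
    cases hx : x σ
    · simp only [signPow_false, hab]
      rw [← hx, Function.update_eq_self]
    · simp only [signPow_true, ← div_eq_mul_inv, hab']
      rw [← hx, Function.update_eq_self]

theorem DependsOn.update_notMem {β : Type} {f : Bits Q → β} {S : Finset Q} (hf : DependsOn f S)
    {τ : Q} (hτ : τ ∉ S) (x : Bits Q) (b : Bool) : f (Function.update x τ b) = f x :=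
  hf fun i hi => Function.update_of_ne (by rintro rfl; exact hτ hi) _ _

variable [Fintype Q]

/-- A multiplexed `z`-rotation followed by a CNOT from one of its control qubits. -/
theorem exists_multiplexed_cnot (S : Finset Q) : ∀ (σ τ : Q), σ ∉ S → τ ∉ insert σ S →
    ∀ f : Bits Q → Circle, DependsOn f (insert σ S : Finset Q) →
    ∃ C : Circuit Q, C.cnotCount + 1 = 2 ^ (S.card + 1) ∧
      ∀ x, Maps C x (signPow (f x) (x τ)) (Function.update x τ (xor (x τ) (x σ))) := by
  induction S using Finset.induction_on with
  | empty =>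
    intro σ τ _ hτ f hf
    have hne : σ ≠ τ := by rintro rfl; simp at hτ
    obtain ⟨a, b, ha, hb, hab⟩ := exists_split hf
    have hconst : ∀ g : Bits Q → Circle, DependsOn g (∅ : Finset Q) → ∀ x y, g x = g y :=
      fun g hg x y => hg (by simp)
    -- The gate before the CNOT sees `x τ`, the gate after it sees `x τ ⊕ x σ`; this yields `b` and
    -- the `σ`-signed `a`.
    refine ⟨[Gate.single (phaseGate (signPow (b fun _ => false))) τ] ++ ([Gate.cnot σ τ hne] ++
      [Gate.single (phaseGate (signPow (a fun _ => false))) τ]), ?_, fun x => ?_⟩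
    · simp only [Circuit.cnotCount_append, Circuit.cnotCount_single, Circuit.cnotCount_cnot]
      simp
    · convert (Maps.phase _ τ x).append ((Maps.cnot σ τ hne x).append (Maps.phase _ τ _)) using 1
      rw [hab, hconst a ha x (fun _ => false), hconst b hb x (fun _ => false), signPow_mul,
        signPow_signPow, one_mul, Function.update_self]
  | insert ρ S hρ ih =>
    intro σ τ hσ hτ f hf
    have hne : σ ≠ τ := by rintro rfl; simp at hτ
    have hτ' : τ ∉ insert ρ S := fun h => hτ (Finset.mem_insert_of_mem h)
    have hρτ : ρ ≠ τ := by rintro rfl; simp at hτ'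
    obtain ⟨a, b, ha, hb, hab⟩ := exists_split hf
    obtain ⟨C, hC, hC'⟩ := ih ρ τ hρ hτ' b hb
    -- `C` leaves `x ρ` added to the target, so the phase for `D` is twisted by `x ρ` to compensate.
    -- The two additions of `x ρ` cancel without any extra gate, and the count is `2 * (2 ^ (|S| +
    -- 1) - 1) + 1`.
    obtain ⟨D, hD, hD'⟩ := ih ρ τ hρ hτ' (fun x => signPow (a x) (x ρ)) (by
      intro x y hxy
      have h1 := ha hxy
      have h2 := hxy ρ (by simp)
      simp only
      rw [h1, h2])
    refine ⟨C ++ ([Gate.cnot σ τ hne] ++ D), ?_, fun x => ?_⟩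
    · simp only [Circuit.cnotCount_append, Circuit.cnotCount_cnot]
      rw [Finset.card_insert_of_notMem hρ]
      rw [pow_succ]
      omega
    · convert (hC' x).append ((Maps.cnot σ τ hne _).append (hD' _)) using 1
      · rw [hab, DependsOn.update_notMem ha hτ', DependsOn.update_notMem ha hτ']
        simp only [Function.update_self, Function.update_of_ne hne, Function.update_of_ne hρτ,
          signPow_mul, signPow_signPow, one_mul]
        congr 2
        cases x τ <;> cases x σ <;> cases x ρ <;> rfl
      · simp only [Function.update_self, Function.update_of_ne hne, Function.update_of_ne hρτ,
          Function.update_idem]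
        congr 1
        cases x τ <;> cases x σ <;> cases x ρ <;> rfl

/-- The multiplexed `z`-rotation with controls `S` costs `2 ^ |S|` CNOTs. -/
theorem exists_multiplexed (S : Finset Q) (τ : Q) (hτ : τ ∉ S) (f : Bits Q → Circle)
    (hf : DependsOn f S) :
    ∃ C : Circuit Q, C.cnotCount ≤ 2 ^ S.card ∧ ∀ x, Maps C x (signPow (f x) (x τ)) x := by
  induction S using Finset.induction_on with
  | empty =>
    refine ⟨[Gate.single (phaseGate (signPow (f fun _ => false))) τ], by
      simp [Circuit.cnotCount_single], fun x => ?_⟩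
    rw [show f x = f fun _ => false from hf (by simp)]
    exact Maps.phase _ τ x
  | insert σ S hσ _ =>
    have hne : σ ≠ τ := by rintro rfl; simp at hτ
    obtain ⟨C, hC, hC'⟩ := exists_multiplexed_cnot S σ τ hσ hτ f hf
    refine ⟨C ++ [Gate.cnot σ τ hne], ?_, fun x => ?_⟩
    · rw [Circuit.cnotCount_append, Circuit.cnotCount_cnot, hC, Finset.card_insert_of_notMem hσ]
    · convert (hC' x).append (Maps.cnot σ τ hne _) using 1
      · simp
      · simp [Function.update_of_ne hne]

/-- An arbitrary diagonal unitary on the qubits `S`. -/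
theorem exists_diagonal [Nonempty Q] (S : Finset Q) : ∀ φ : Bits Q → Circle, DependsOn φ S →
    ∃ C : Circuit Q, C.cnotCount + 1 ≤ 2 ^ S.card ∧ ∀ x, Maps C x (φ x) x := by
  induction S using Finset.induction_on with
  | empty =>
    intro φ hφ
    refine ⟨[Gate.single (phaseGate fun _ => φ fun _ => false) (Classical.arbitrary Q)], by
      simp [Circuit.cnotCount_single], fun x => ?_⟩
    rw [show φ x = φ fun _ => false from hφ (by simp)]
    exact Maps.phase _ _ x
  | insert σ S hσ ih =>
    intro φ hφ
    obtain ⟨a, b, ha, hb, hab⟩ := exists_split hφ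
    obtain ⟨C, hC, hC'⟩ := ih b hb
    obtain ⟨D, hD, hD'⟩ := exists_multiplexed S σ hσ a ha
    refine ⟨C ++ D, ?_, fun x => ?_⟩
    · rw [Circuit.cnotCount_append, Finset.card_insert_of_notMem hσ, pow_succ]
      omega
    · rw [hab]
      exact (hC' x).append (hD' x)

/-- XORing a Boolean function of the qubits `S` onto another qubit. -/
theorem exists_xor (S : Finset Q) (τ : Q) (hτ : τ ∉ S) (h : Bits Q → Bool) (hh : DependsOn h S) :
    ∃ C : Circuit Q, C.cnotCount ≤ 2 ^ (S.card + 1) ∧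
      ∀ x, Maps C x 1 (Function.update x τ (xor (x τ) (h x))) := by
  have : Nonempty Q := ⟨τ⟩
  obtain ⟨D, hD, hD'⟩ := exists_diagonal (insert τ S) (fun x => if h x && x τ then -1 else 1) (by
    intro x y hxy
    have h1 : h x = h y := hh fun i hi => hxy i (by simp_all)
    have h2 : x τ = y τ := hxy τ (by simp)
    simp only [h1, h2])
  refine ⟨_, ?_, Maps.hadamard_conj (DependsOn.update_notMem hh hτ) hD'⟩
  rw [Finset.card_insert_of_notMem hτ] at hD
  simp only [Circuit.cnotCount_append, Circuit.cnotCount_single]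
  omega

/-- XORing one Boolean function onto each qubit of `W`, none of them depending on `W`. -/
theorem exists_multiXor (W : Finset Q) (S : Q → Finset Q) (h : Q → Bits Q → Bool) (s : ℕ)
    (hs : ∀ q ∈ W, (S q).card ≤ s) (hh : ∀ q ∈ W, DependsOn (h q) (S q))
    (hW : ∀ q ∈ W, Disjoint (S q) W) :
    ∃ C : Circuit Q, C.cnotCount ≤ W.card * 2 ^ (s + 1) ∧
      ∀ x, Maps C x 1 (fun q => if q ∈ W then xor (x q) (h q x) else x q) := by
  suffices H : ∀ V ⊆ W, ∃ C : Circuit Q, C.cnotCount ≤ V.card * 2 ^ (s + 1) ∧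
      ∀ x, Maps C x 1 (fun q => if q ∈ V then xor (x q) (h q x) else x q) from
    H W subset_rfl
  intro V
  induction V using Finset.induction_on with
  | empty => exact fun _ => ⟨[], by simp [Circuit.cnotCount], fun x => by simpa using Maps.nil x⟩
  | insert τ V hτ ih =>
    intro hV
    have hτW : τ ∈ W := hV (Finset.mem_insert_self _ _)
    have hVW : V ⊆ W := (Finset.subset_insert _ _).trans hV
    obtain ⟨C, hC, hC'⟩ := ih hVW
    obtain ⟨D, hD, hD'⟩ := exists_xor (S τ) τ
      (fun hm => Finset.disjoint_left.1 (hW τ hτW) hm hτW) (h τ) (hh τ hτW)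
    refine ⟨C ++ D, ?_, fun x => ?_⟩
    · rw [Circuit.cnotCount_append, Finset.card_insert_of_notMem hτ, add_mul, one_mul]
      exact add_le_add hC (hD.trans (Nat.pow_le_pow_right two_pos (by have := hs τ hτW; omega)))
    · convert (hC' x).append (hD' _) using 1
      · simp
      · have e : h τ (fun q => if q ∈ V then xor (x q) (h q x) else x q) = h τ x :=
          hh τ hτW fun i hi => if_neg fun hm => Finset.disjoint_left.1 (hW τ hτW) hi (hVW hm)
        rw [e]
        funext q
        by_cases hq : q = τ
        · subst hq; simp [hτ]
        · simp [hq]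

/-- Circuits that act diagonally on the basis states satisfying `P` compose. -/
theorem exists_prod {α : Type} (s : Finset α) (P : Bits Q → Prop) (φ : α → Bits Q → Circle)
    (c : ℕ) (H : ∀ l ∈ s, ∃ C : Circuit Q, C.cnotCount ≤ c ∧ ∀ x, P x → Maps C x (φ l x) x) :
    ∃ C : Circuit Q, C.cnotCount ≤ s.card * c ∧ ∀ x, P x → Maps C x (∏ l ∈ s, φ l x) x := by
  classical
  induction s using Finset.induction_on with
  | empty => exact ⟨[], by simp [Circuit.cnotCount], fun x _ => by simpa using Maps.nil x⟩
  | insert l s hl ih =>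
    obtain ⟨C, hC, hC'⟩ := ih fun l hl => H l (Finset.mem_insert_of_mem hl)
    obtain ⟨D, hD, hD'⟩ := H l (Finset.mem_insert_self _ _)
    refine ⟨D ++ C, ?_, fun x hx => ?_⟩
    · rw [Circuit.cnotCount_append, Finset.card_insert_of_notMem hl, add_mul, one_mul]
      omega
    · rw [Finset.prod_insert hl]
      exact (hD' x hx).append (hC' x hx)

end Oracles

/-! ### Telescoping over slices for a pair of inputs. -/

/-- The phase `f(u)^{±1}`, where the sign is controlled by the qubit `none`. -/
noncomputable def signedPhase {N : Type} (f : Bits N → Circle) (u : Bits (Option N)) : Circle :=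
  signPow (f fun i => u (some i)) (u none)

section Telescope

variable {M K : Type}

/-- The part of the input `u` that indexes the slice of `f`. -/
def sliceIndex (u : Bits (Option (M ⊕ K))) : Bits K := fun i => u (some (Sum.inr i))

/-- The input `u` with the slice index removed. -/
def sliceData (u : Bits (Option (M ⊕ K))) : Bits (Option M) := fun o => u (o.map Sum.inl)

/-- Negate the control bit. -/
def flipControl (d : Bits (Option M)) : Bits (Option M) :=
  fun o => o.elim (!d none) fun i => d (some i)

open Classical in
/-- The `l`-th slice of `f` in the enumeration `v`, extended by `1`. -/
noncomputable def slice (v : Bits K → ℕ) (f : Bits (M ⊕ K) → Circle) (l : ℕ) (u : Bits M) :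
    Circle :=
  if h : ∃ i, v i = l then f (Sum.elim u h.choose) else 1

/-- The quotient of consecutive slices. -/
noncomputable def sliceRatio (v : Bits K → ℕ) (f : Bits (M ⊕ K) → Circle) : ℕ → Bits M → Circle
  | 0, u => slice v f 0 u
  | l + 1, u => slice v f (l + 1) u / slice v f l u

theorem prod_sliceRatio (v : Bits K → ℕ) (f : Bits (M ⊕ K) → Circle) (m : ℕ) (u : Bits M) :
    ∏ l ∈ Finset.range (m + 1), sliceRatio v f l u = slice v f m u := by
  induction m with
  | zero => simp [sliceRatio]
  | succ m ih => rw [Finset.prod_range_succ, ih, sliceRatio, mul_div_cancel]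

theorem signPow_slice {v : Bits K → ℕ} (hv : Function.Injective v) (f : Bits (M ⊕ K) → Circle)
    (u : Bits (Option (M ⊕ K))) :
    signPow (slice v f (v (sliceIndex u)) fun i => sliceData u (some i)) (sliceData u none) =
      signedPhase f u := by
  have h : ∃ i, v i = v (sliceIndex u) := ⟨_, rfl⟩
  rw [slice, dif_pos h, hv h.choose_spec, signedPhase]
  congr 2
  funext i
  cases i <;> rfl

theorem signPow_prod {α : Type} (s : Finset α) (g : α → Circle) (b : Bool) :
    ∏ l ∈ s, signPow (g l) b = signPow (∏ l ∈ s, g l) b := by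
  cases b <;> simp

theorem signPow_not (z : Circle) (b : Bool) : signPow z (!b) = (signPow z b)⁻¹ := by
  cases b <;> simp

/-- Input to the `l`-th slice ratio for a pair of inputs whose slice indices are ordered. -/
def selectOrdered (v : Bits K → ℕ) (l : ℕ) (lo hi : Bits (Option (M ⊕ K))) : Bits (Option M) :=
  if l ≤ v (sliceIndex lo) then sliceData lo
  else if v (sliceIndex hi) < l then flipControl (sliceData hi)
  else fun _ => false

/-- Correction of the phase arising when neither input is selected. -/
noncomputable def correctOrdered (v : Bits K → ℕ) (f : Bits (M ⊕ K) → Circle) (l : ℕ)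
    (i j : Bits K) : Circle :=
  if l ≤ v i then 1 else if v j < l then 1 else (sliceRatio v f l fun _ => false)⁻¹

/-- Input to the `l`-th slice ratio for a pair of inputs. -/
def select (v : Bits K → ℕ) (l : ℕ) (u u' : Bits (Option (M ⊕ K))) : Bits (Option M) :=
  if v (sliceIndex u) ≤ v (sliceIndex u') then selectOrdered v l u u' else selectOrdered v l u' u

/-- The correction phase for a pair of inputs. -/
noncomputable def correct (v : Bits K → ℕ) (f : Bits (M ⊕ K) → Circle) (l : ℕ)
    (i j : Bits K) : Circle :=
  if v i ≤ v j then correctOrdered v f l i j else correctOrdered v f l j i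

theorem prod_range_ite_le {L i : ℕ} (hi : i ≤ L) (a : ℕ → Circle) :
    ∏ l ∈ Finset.range (L + 1), (if l ≤ i then a l else 1) = ∏ l ∈ Finset.range (i + 1), a l := by
  rw [← Finset.prod_filter]
  congr 1
  ext l
  simp only [Finset.mem_filter, Finset.mem_range]
  omega

/-- The input `lo` collects the ratios up to its own index, and `hi` the inverted ratios beyond its
index. In between, the all-false input contributes a known phase, which the correction cancels. -/
theorem prod_selectOrdered {v : Bits K → ℕ} (hv : Function.Injective v) {L : ℕ}
    (hL : ∀ i, v i < L) (f : Bits (M ⊕ K) → Circle) (lo hi : Bits (Option (M ⊕ K)))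
    (h : v (sliceIndex lo) ≤ v (sliceIndex hi)) :
    ∏ l ∈ Finset.range (L + 1), (signedPhase (sliceRatio v f l) (selectOrdered v l lo hi) *
      correctOrdered v f l (sliceIndex lo) (sliceIndex hi)) =
      signedPhase f lo * signedPhase f hi := by
  -- No slice has index `L`, so the default value `1` applies and the full product of ratios
  -- telescopes to `1`.
  have hLslice : ∀ u : Bits M, slice v f L u = 1 := fun u => by
    rw [slice, dif_neg]
    rintro ⟨i, hi⟩
    exact (hL i).ne hi
  set a : ℕ → Circle := fun l => signPow (sliceRatio v f l fun i => sliceData lo (some i))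
    (sliceData lo none) with ha
  set b : ℕ → Circle := fun l => signPow (sliceRatio v f l fun i => sliceData hi (some i))
    (sliceData hi none) with hb
  -- The factor `(b l)⁻¹` for `l > v (sliceIndex hi)` is written for all `l` and cancelled below. As
  -- the `b l` multiply to `1`, only the product over `l ≤ v (sliceIndex hi)` remains.
  have hterm : ∀ l, signedPhase (sliceRatio v f l) (selectOrdered v l lo hi) *
      correctOrdered v f l (sliceIndex lo) (sliceIndex hi) =
      (if l ≤ v (sliceIndex lo) then a l else 1) *
        ((b l)⁻¹ * if l ≤ v (sliceIndex hi) then b l else 1) := by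
    intro l
    unfold selectOrdered correctOrdered
    by_cases h1 : l ≤ v (sliceIndex lo)
    · simp [h1, h1.trans h, ha, signedPhase]
    · by_cases h2 : v (sliceIndex hi) < l
      · simp [h1, h2, not_le.2 h2, hb, signedPhase, flipControl, signPow_not]
      · simp [h1, h2, not_lt.1 h2, signedPhase]
  have hB : ∏ l ∈ Finset.range (L + 1), b l = 1 := by
    rw [hb, signPow_prod, prod_sliceRatio, hLslice]
    cases sliceData hi none <;> simp
  rw [Finset.prod_congr rfl fun l _ => hterm l, Finset.prod_mul_distrib, Finset.prod_mul_distrib,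
    Finset.prod_inv_distrib, hB, prod_range_ite_le (hL _).le, prod_range_ite_le (hL _).le, ha, hb,
    signPow_prod, signPow_prod, prod_sliceRatio, prod_sliceRatio, signPow_slice hv,
    signPow_slice hv, inv_one, one_mul]

theorem prod_select {v : Bits K → ℕ} (hv : Function.Injective v) {L : ℕ}
    (hL : ∀ i, v i < L) (f : Bits (M ⊕ K) → Circle) (u u' : Bits (Option (M ⊕ K))) :
    ∏ l ∈ Finset.range (L + 1), (signedPhase (sliceRatio v f l) (select v l u u') *
      correct v f l (sliceIndex u) (sliceIndex u')) = signedPhase f u * signedPhase f u' := by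
  unfold select correct
  split_ifs with h
  · exact prod_selectOrdered hv hL f u u' h
  · rw [prod_selectOrdered hv hL f u' u (not_le.1 h).le, mul_comm]

/-- Locality makes selection cheap: each selected bit involves two slice indices and two data bits,
hence `2 * |K| + 2` qubits, however large `M` is. -/
theorem select_congr {v : Bits K → ℕ} {l : ℕ} {u u' w w' : Bits (Option (M ⊕ K))} {o : Option M}
    (h1 : sliceIndex u = sliceIndex w) (h2 : sliceIndex u' = sliceIndex w')
    (h3 : sliceData u o = sliceData w o) (h4 : sliceData u' o = sliceData w' o) :
    select v l u u' o = select v l w w' o := by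
  have hf : ∀ d d' : Bits (Option M), d o = d' o → flipControl d o = flipControl d' o := by
    intro d d' hd
    cases o <;> simp_all [flipControl]
  have h5 := hf _ _ h3
  have h6 := hf _ _ h4
  unfold select selectOrdered
  rw [h1, h2]
  split_ifs <;> first | assumption | rfl

end Telescope

/-! ### The mass-production recursion. -/

/-- With `c` CNOTs and clean ancillas, one can apply `f̄` to each of the `R` copies of its
`N + 1` input qubits, inside any register. -/
def MassProduces (R N : Type) [Fintype R] (c : ℕ) : Prop :=
  -- The ancillas are fixed before `f`, so the same ones serve every slice ratio in turn; the
  -- arbitrary register lets the recursive call run on qubits inside a larger one.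
  ∃ (A : Type) (_ : Fintype A), ∀ (f : Bits N → Circle) (Q : Type) [Fintype Q] [DecidableEq Q]
    (e : R × Option N → Q) (w : A → Q), Function.Injective (Sum.elim e w) →
    ∃ C : Circuit Q, C.cnotCount ≤ c ∧ ∀ x : Bits Q, (∀ k, x (w k) = false) →
      Maps C x (∏ ρ, signedPhase f fun o => x (e (ρ, o))) x

theorem MassProduces.mono {R N : Type} [Fintype R] {c d : ℕ} (h : MassProduces R N c)
    (hcd : c ≤ d) : MassProduces R N d := by
  obtain ⟨A, hA, H⟩ := h
  refine ⟨A, hA, fun f Q _ _ e w hew => ?_⟩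
  obtain ⟨C, hC, hC'⟩ := H f Q e w hew
  exact ⟨C, hC.trans hcd, hC'⟩

theorem MassProduces.congr {R R' N N' : Type} [Fintype R] [Fintype R'] {c : ℕ}
    (h : MassProduces R N c) (α : R ≃ R') (β : N ≃ N') : MassProduces R' N' c := by
  obtain ⟨A, hA, H⟩ := h
  refine ⟨A, hA, fun f Q _ _ e w hew => ?_⟩
  obtain ⟨C, hC, hC'⟩ := H (fun u => f fun i => u (β.symm i)) Q
    (fun p => e (α p.1, p.2.map β)) w (by
      have hinj : Function.Injective
          (Sum.map (fun p : R × Option N => (α p.1, p.2.map β)) (id : A → A)) := by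
        refine Function.Injective.sumMap ?_ Function.injective_id
        rintro ⟨a, o⟩ ⟨a', o'⟩ h
        simp only [Prod.mk.injEq] at h
        exact Prod.ext (α.injective h.1) (Option.map_injective β.injective h.2)
      convert hew.comp hinj using 1
      ext (_ | _) <;> rfl)
  refine ⟨C, hC, fun x hx => ?_⟩
  convert hC' x hx using 1
  rw [← α.prod_comp]
  refine Finset.prod_congr rfl fun ρ _ => ?_
  simp [signedPhase]

/-- The direct implementation, one copy after the other. -/
theorem massProduces_direct (R N : Type) [Fintype R] [Fintype N] :
    MassProduces R N (Fintype.card R * 2 ^ Fintype.card N) := by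
  refine ⟨Empty, inferInstance, fun f Q _ _ e w hew => ?_⟩
  have he : Function.Injective e := fun a b h => Sum.inl_injective (hew (by simpa using h))
  refine exists_prod Finset.univ _ (fun ρ x => signedPhase f fun o => x (e (ρ, o))) _
    fun ρ _ => ?_
  obtain ⟨C, hC, hC'⟩ := exists_multiplexed (Finset.univ.image fun i : N => e (ρ, some i))
    (e (ρ, none)) (by simp [he.eq_iff]) (fun x => f fun i => x (e (ρ, some i))) (by
      intro x y hxy
      simp only
      congr 1
      funext i
      exact hxy _ (by simp))
  refine ⟨C, hC.trans (Nat.pow_le_pow_right two_pos Finset.card_image_le), fun x _ => hC' x⟩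

/-- Surplus copies act on clean ancillas, up to a global phase that one gate removes. -/
theorem MassProduces.of_sum {R E N : Type} [Fintype R] [Fintype E] [Fintype N] [Nonempty R] {c : ℕ}
    (h : MassProduces (R ⊕ E) N c) : MassProduces R N c := by
  obtain ⟨A, hA, H⟩ := h
  refine ⟨A ⊕ (E × Option N), inferInstance, fun f Q _ _ e w hew => ?_⟩
  obtain ⟨C, hC, hC'⟩ := H f Q
    (fun p => p.1.elim (fun ρ => e (ρ, p.2)) fun ε => w (Sum.inr (ε, p.2)))
    (fun k => w (Sum.inl k)) (by
      let m : (R ⊕ E) × Option N ⊕ A → (R × Option N) ⊕ (A ⊕ (E × Option N)) :=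
        Sum.elim (fun p => p.1.elim (fun ρ => Sum.inl (ρ, p.2)) fun ε => Sum.inr (Sum.inr (ε, p.2)))
          fun k => Sum.inr (Sum.inl k)
      let m' : (R × Option N) ⊕ (A ⊕ (E × Option N)) → (R ⊕ E) × Option N ⊕ A :=
        Sum.elim (fun p => Sum.inl (Sum.inl p.1, p.2))
          (Sum.elim Sum.inr fun p => Sum.inl (Sum.inr p.1, p.2))
      have hm : Function.Injective m := Function.LeftInverse.injective (g := m') <| by
        rintro (⟨_ | _, _⟩ | _) <;> rfl
      convert hew.comp hm using 1
      ext (⟨_ | _, _⟩ | _) <;> rfl)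
  have : Nonempty Q := ⟨e (Classical.arbitrary R, none)⟩
  obtain ⟨D, hD, hD'⟩ := exists_diagonal (Q := Q) ∅
    (fun _ => (∏ _ε : E, signedPhase f fun _ => false)⁻¹) (fun _ _ _ => rfl)
  refine ⟨C ++ D, ?_, fun x hx => ?_⟩
  · rw [Circuit.cnotCount_append]
    simp only [Finset.card_empty, pow_zero] at hD
    omega
  · convert (hC' x fun k => hx _).append (hD' x) using 1
    rw [Fintype.prod_sum_type]
    simp [hx]

/-- One level of the recursion: two copies of `f` for `2 ^ |K| + 1` functions with `|K|` fewer
input bits. -/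
theorem MassProduces.double {R M : Type} (K : Type) [Fintype R] [Fintype M] [Fintype K] {c : ℕ}
    (h : MassProduces R M c) :
    MassProduces (R × Bool) (M ⊕ K) ((2 ^ Fintype.card K + 1) *
      (c + Fintype.card R * (Fintype.card M + 2) * 2 ^ (2 * Fintype.card K + 4))) := by
  classical
  obtain ⟨A, hA, H⟩ := h
  obtain ⟨v, hv, hL⟩ : ∃ v : Bits K → ℕ, Function.Injective v ∧ ∀ i, v i < 2 ^ Fintype.card K := by
    have hcard : Fintype.card (Bits K) = 2 ^ Fintype.card K := by simp
    refine ⟨fun i => (Fintype.equivFinOfCardEq hcard i : ℕ), ?_, fun i => Fin.is_lt _⟩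
    exact Fin.val_injective.comp (Equiv.injective _)
  refine ⟨A ⊕ (R × Option M), inferInstance, fun f Q _ _ e w hew => ?_⟩
  have he : Function.Injective e := fun a b h => Sum.inl_injective (hew (by simpa using h))
  have hw : Function.Injective w := fun a b h => Sum.inr_injective (hew (by simpa using h))
  have hne : ∀ a b, e a ≠ w b := fun a b h => by
    have := @hew (Sum.inl a) (Sum.inr b) (by simpa using h)
    simp at this
  set w' : R × Option M → Q := fun p => w (Sum.inr p) with hw'
  have hw'inj : Function.Injective w' := hw.comp Sum.inr_injective
  set inp : Bits Q → R → Bool → Bits (Option (M ⊕ K)) := fun x ρ b o => x (e ((ρ, b), o)) with hinp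
  -- the qubits on which a selected bit depends
  set S : R × Option M → Finset Q := fun p => Finset.univ.image fun q : Bool × Option K =>
    e ((p.1, q.1), q.2.elim (p.2.map Sum.inl) fun i => some (Sum.inr i)) with hS
  have hScard : ∀ p, (S p).card ≤ 2 * Fintype.card K + 2 := fun p => by
    refine Finset.card_image_le.trans ?_
    simp only [Finset.card_univ, Fintype.card_prod, Fintype.card_bool, Fintype.card_option]
    omega
  have hSidx : ∀ p (x y : Bits Q), (∀ i ∈ S p, x i = y i) → ∀ b,
      (sliceIndex (inp x p.1 b) : Bits K) = sliceIndex (inp y p.1 b) := fun p x y hxy b => by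
    funext i
    exact hxy _ (Finset.mem_image.2 ⟨(b, some i), Finset.mem_univ _, rfl⟩)
  have hSdata : ∀ p (x y : Bits Q), (∀ i ∈ S p, x i = y i) → ∀ b,
      sliceData (inp x p.1 b) p.2 = sliceData (inp y p.1 b) p.2 := fun p x y hxy b =>
    hxy _ (Finset.mem_image.2 ⟨(b, none), Finset.mem_univ _, rfl⟩)
  have hSe : ∀ p, ∀ q ∈ S p, ∃ a, q = e a := fun p q hq => by
    obtain ⟨a, _, rfl⟩ := Finset.mem_image.1 hq
    exact ⟨_, rfl⟩
  set W : Finset Q := Finset.univ.image w' with hWdef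
  have hWmem : ∀ p, w' p ∈ W := fun p => Finset.mem_image_of_mem _ (Finset.mem_univ _)
  have heW : ∀ a, e a ∉ W := fun a ha => by
    obtain ⟨p, _, hp⟩ := Finset.mem_image.1 ha
    exact hne _ _ hp.symm
  have hwA : ∀ k, w (Sum.inl k) ∉ W := fun k hk => by
    obtain ⟨p, _, hp⟩ := Finset.mem_image.1 hk
    have := hw hp
    simp at this
  -- one stage
  have stage : ∀ l, ∃ C : Circuit Q, C.cnotCount ≤
      c + Fintype.card R * (Fintype.card M + 2) * 2 ^ (2 * Fintype.card K + 4) ∧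
      ∀ x : Bits Q, (∀ k, x (w k) = false) → Maps C x (∏ ρ,
        (signedPhase (sliceRatio v f l) (select v l (inp x ρ false) (inp x ρ true)) *
          correct v f l (sliceIndex (inp x ρ false)) (sliceIndex (inp x ρ true)))) x := by
    intro l
    set g : Q → Bits Q → Bool := Function.extend w'
      (fun p x => select v l (inp x p.1 false) (inp x p.1 true) p.2) fun _ _ => false with hg
    have hgw : ∀ p x, g (w' p) x = select v l (inp x p.1 false) (inp x p.1 true) p.2 :=
      fun p x => by rw [hg, hw'inj.extend_apply]
    have hSw : ∀ p, Function.extend w' S (fun _ => ∅) (w' p) = S p :=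
      fun p => by rw [hw'inj.extend_apply]
    obtain ⟨X, hX, hX'⟩ := exists_multiXor W (Function.extend w' S fun _ => ∅) g
      (2 * Fintype.card K + 2)
      (by
        intro q hq
        obtain ⟨p, _, rfl⟩ := Finset.mem_image.1 hq
        rw [hSw]
        exact hScard p)
      (by
        intro q hq
        obtain ⟨p, _, rfl⟩ := Finset.mem_image.1 hq
        rw [hSw]
        intro x y hxy
        rw [hgw, hgw]
        exact select_congr (hSidx p x y hxy _) (hSidx p x y hxy _) (hSdata p x y hxy _)
          (hSdata p x y hxy _))
      (by
        intro q hq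
        obtain ⟨p, _, rfl⟩ := Finset.mem_image.1 hq
        rw [hSw, Finset.disjoint_left]
        intro q hq
        obtain ⟨a, rfl⟩ := hSe p q hq
        exact heW a)
    obtain ⟨D, hD, hD'⟩ := H (sliceRatio v f l) Q w' (fun k => w (Sum.inl k)) (by
      have hsw : Function.Injective (Sum.swap : (R × Option M) ⊕ A → A ⊕ (R × Option M)) :=
        (Equiv.sumComm _ _).injective
      convert hw.comp hsw using 1
      ext (_ | _) <;> rfl)
    obtain ⟨E, hE, hE'⟩ := exists_prod (Finset.univ : Finset R) (fun _ : Bits Q => True)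
      (fun ρ x => correct v f l (sliceIndex (inp x ρ false)) (sliceIndex (inp x ρ true)))
      (2 ^ (2 * Fintype.card K + 2)) (by
        intro ρ _
        have : Nonempty Q := ⟨e ((ρ, false), none)⟩
        obtain ⟨C, hC, hC'⟩ := exists_diagonal (S (ρ, none))
          (fun x => correct v f l (sliceIndex (inp x ρ false)) (sliceIndex (inp x ρ true))) (by
            intro x y hxy
            have h1 := hSidx (ρ, none) x y hxy false
            have h2 := hSidx (ρ, none) x y hxy true
            simp only at h1 h2 ⊢
            rw [h1, h2])
        exact ⟨C, (Nat.le_of_succ_le hC).trans (Nat.pow_le_pow_right two_pos (hScard _)),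
          fun x _ => hC' x⟩)
    -- Select, apply the ratio, unselect, correct. `X` undoes itself because the selected bits do
    -- not depend on the qubits of `W` that receive them.
    refine ⟨X ++ (D ++ (X ++ E)), ?_, fun x hx => ?_⟩
    · have hWcard : W.card = Fintype.card R * (Fintype.card M + 1) := by
        rw [hWdef, Finset.card_image_of_injective _ hw'inj]
        simp
      rw [hWcard] at hX
      rw [Finset.card_univ] at hE
      simp only [Circuit.cnotCount_append]
      calc _ ≤ Fintype.card R * (Fintype.card M + 1) * 2 ^ (2 * Fintype.card K + 2 + 1) +
            (c + (Fintype.card R * (Fintype.card M + 1) * 2 ^ (2 * Fintype.card K + 2 + 1) +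
              Fintype.card R * 2 ^ (2 * Fintype.card K + 2))) := by gcongr
        _ ≤ _ := by
          rw [pow_add 2 _ 1, pow_add 2 _ 2, pow_add 2 _ 4]
          nlinarith [Nat.zero_le (Fintype.card R * 2 ^ (2 * Fintype.card K))]
    · set y : Bits Q := fun q => if q ∈ W then xor (x q) (g q x) else x q with hy
      have hyinp : ∀ ρ b, inp y ρ b = inp x ρ b := fun ρ b => by
        funext o
        simp only [hinp, hy]
        rw [if_neg (heW _)]
      have hyw : ∀ p, y (w' p) = select v l (inp x p.1 false) (inp x p.1 true) p.2 := fun p => by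
        simp only [hy]
        rw [if_pos (hWmem p), hgw, hx (Sum.inr p), Bool.false_xor]
      have hback : (fun q => if q ∈ W then xor (y q) (g q y) else y q) = x := by
        funext q
        by_cases hq : q ∈ W
        · rw [if_pos hq]
          obtain ⟨p, _, rfl⟩ := Finset.mem_image.1 hq
          rw [hyw, hgw, hyinp, hyinp, Bool.xor_self]
          exact (hx (Sum.inr p)).symm
        · rw [if_neg hq]
          simp only [hy]
          rw [if_neg hq]
      have h2 := hD' y fun k => by
        simp only [hy]
        rw [if_neg (hwA k)]
        exact hx _
      have h3 := hX' y
      rw [hback] at h3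
      convert (hX' x).append (h2.append (h3.append (hE' x trivial))) using 1
      rw [one_mul, one_mul, Finset.prod_mul_distrib]
      congr 1
      refine Finset.prod_congr rfl fun ρ _ => ?_
      congr 1
      funext o
      exact (hyw (ρ, o)).symm
  obtain ⟨C, hC, hC'⟩ := exists_prod (Finset.range (2 ^ Fintype.card K + 1))
    (fun x : Bits Q => ∀ k, x (w k) = false) _ _ fun l _ => stage l
  refine ⟨C, by simpa using hC, fun x hx => ?_⟩
  convert hC' x hx using 1
  rw [Finset.prod_comm, Fintype.prod_prod_type]
  refine Finset.prod_congr rfl fun ρ _ => ?_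
  rw [prod_select hv hL, Fintype.prod_bool, mul_comm]

/-- The recursion unrolled `t` times, in terms of the numbers of copies and of input bits. -/
theorem massProduces_pow (k m n : ℕ) : ∀ t, m + k * t ≤ n →
    MassProduces (Fin (2 ^ t)) (Fin (m + k * t))
      ((2 ^ k + 1) ^ t * (2 ^ m + t * 2 ^ t * ((n + 2) * 2 ^ (2 * k + 4)))) := by
  intro t
  induction t with
  | zero => exact fun _ => (massProduces_direct _ _).mono (by simp)
  | succ t ih =>
    intro ht
    have hle : m + k * t ≤ n := by rw [mul_add] at ht; omega
    have h := ((ih hle).double (Fin k)).congr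
      (R' := Fin (2 ^ (t + 1))) (N' := Fin (m + k * (t + 1)))
      (Fintype.equivOfCardEq (by simp [pow_succ])) (Fintype.equivOfCardEq (by simp; ring))
    refine h.mono ?_
    simp only [Fintype.card_fin]
    -- Since `n` bounds the input length at every level, one quantity `P` bounds the selection cost
    -- per copy and ratio throughout the recursion.
    set P := (n + 2) * 2 ^ (2 * k + 4) with hP
    have h1 : 2 ^ t * (m + k * t + 2) * 2 ^ (2 * k + 4) ≤ 2 ^ t * P := by
      rw [hP, ← mul_assoc]
      gcongr
    have h2 : 2 ^ t * P ≤ (2 ^ k + 1) ^ t * (2 ^ t * P) :=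
      Nat.le_mul_of_pos_left _ (by positivity)
    have h3 : t * 2 ^ t * P + 2 ^ t * P ≤ (t + 1) * 2 ^ (t + 1) * P := by
      have : t * 2 ^ t + 2 ^ t ≤ (t + 1) * 2 ^ (t + 1) := by
        rw [pow_succ]
        nlinarith [Nat.zero_le ((t + 1) * 2 ^ t)]
      calc _ = (t * 2 ^ t + 2 ^ t) * P := by ring
        _ ≤ _ := by gcongr
    calc _ ≤ (2 ^ k + 1) * ((2 ^ k + 1) ^ t * (2 ^ m + t * 2 ^ t * P) +
          (2 ^ k + 1) ^ t * (2 ^ t * P)) := by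
          exact Nat.mul_le_mul_left _ (Nat.add_le_add_left (h1.trans h2) _)
      _ = (2 ^ k + 1) ^ (t + 1) * (2 ^ m + (t * 2 ^ t * P + 2 ^ t * P)) := by ring
      _ ≤ _ := by gcongr

/-! ### From phases on basis states to the operators of the statement. -/

theorem bar_eq_signedPhase {n : ℕ} (f : Bits (Fin n) → Circle) (v : Bits (Fin (n + 1))) :
    bar f v = signedPhase f fun o => v (finSuccEquivLast.symm o) := by
  unfold bar signedPhase
  simp only [finSuccEquivLast_symm_some, finSuccEquivLast_symm_none]
  cases v (Fin.last n) <;> simp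

theorem tensorPow_diagOp {ι : Type} [Fintype ι] [DecidableEq ι] (r : ℕ) (φ : Bits ι → Circle) :
    tensorPow r (diagOp φ) =
      Matrix.diagonal fun x => ((∏ k : Fin r, φ fun i => x (k, i) : Circle) : ℂ) := by
  ext y x
  simp only [tensorPow, diagOp, Matrix.of_apply, Matrix.diagonal_apply]
  by_cases h : y = x
  · subst h
    simp only [if_true]
    exact (map_prod Circle.coeHom _ _).symm
  · rw [if_neg h]
    obtain ⟨⟨k, i⟩, hk⟩ := Function.ne_iff.1 h
    refine Finset.prod_eq_zero (Finset.mem_univ k) (if_neg fun he => hk ?_)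
    exact congrFun he i

theorem implements_of_maps {ι : Type} [Fintype ι] [DecidableEq ι] {a : ℕ}
    {C : Circuit (ι ⊕ Fin a)} {φ : Bits ι → Circle}
    (h : ∀ x, (∀ k, x (Sum.inr k) = false) → Maps C x (φ fun i => x (Sum.inl i)) x) :
    C.Implements (Matrix.diagonal fun x => (φ x : ℂ)) := by
  intro ψ
  ext y
  have key : ∀ x, Circuit.toOp C y x * withAncillas a ψ x =
      if y = x then withAncillas a (Matrix.diagonal (fun x => (φ x : ℂ)) *ᵥ ψ) x else 0 := by
    intro x
    by_cases hx : ∀ k : Fin a, x (Sum.inr k) = false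
    · have h1 := congrFun (h x hx) y
      simp only [mulVec_single_one, Matrix.col_apply, Pi.smul_apply, Pi.single_apply, smul_eq_mul,
        mul_ite, mul_one, mul_zero] at h1
      rw [h1, withAncillas, if_pos hx, withAncillas, if_pos hx, Matrix.mulVec_diagonal, ite_mul,
        zero_mul]
    · simp [withAncillas, if_neg hx]
  simp only [Matrix.mulVec, dotProduct] at key ⊢
  rw [Finset.sum_congr rfl fun x _ => key x]
  simp

theorem MassProduces.exists_circuit {r n c : ℕ} (h : MassProduces (Fin r) (Fin n) c)
    (f : Bits (Fin n) → Circle) :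
    ∃ (a : ℕ) (C : Circuit ((Fin r × Fin (n + 1)) ⊕ Fin a)),
      C.Implements (tensorPow r (diagOp (bar f))) ∧ C.cnotCount ≤ c := by
  obtain ⟨A, hA, H⟩ := h
  let m : Fin r × Option (Fin n) → Fin r × Fin (n + 1) :=
    fun p => (p.1, finSuccEquivLast.symm p.2)
  have hm : Function.Injective m :=
    Function.injective_id.prodMap (Equiv.injective finSuccEquivLast.symm)
  obtain ⟨C, hC, hC'⟩ := H f ((Fin r × Fin (n + 1)) ⊕ Fin (Fintype.card A))
    (fun p => Sum.inl (m p)) (fun k => Sum.inr (Fintype.equivFin A k)) (by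
      convert hm.sumMap (Fintype.equivFin A).injective using 1
      ext (_ | _) <;> rfl)
  refine ⟨_, C, ?_, hC⟩
  rw [tensorPow_diagOp]
  refine implements_of_maps (φ := fun x => ∏ k : Fin r, bar f fun i => x (k, i)) fun x hx => ?_
  simp only [bar_eq_signedPhase]
  exact hC' x fun k => hx _

/-- `r` copies by padding to `2 ^ clog₂ r` of them. -/
theorem massProduces_clog {r n k : ℕ} (hr : 0 < r) (h : k * Nat.clog 2 r ≤ n) :
    MassProduces (Fin r) (Fin n) ((2 ^ k + 1) ^ Nat.clog 2 r * (2 ^ (n - k * Nat.clog 2 r) +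
      Nat.clog 2 r * 2 ^ Nat.clog 2 r * ((n + 2) * 2 ^ (2 * k + 4)))) := by
  set t := Nat.clog 2 r
  have hrt : r ≤ 2 ^ t := Nat.le_pow_clog one_lt_two r
  have : Nonempty (Fin r) := ⟨⟨0, hr⟩⟩
  have h1 := massProduces_pow k (n - k * t) n t (Nat.sub_add_cancel h).le
  have h2 := h1.congr (R' := Fin r ⊕ Fin (2 ^ t - r)) (N' := Fin n)
    (Fintype.equivOfCardEq (by simp; omega)) (finCongr (Nat.sub_add_cancel h))
  exact h2.of_sum

/-! ### Asymptotics of the cost. -/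

section Asymptotic

variable {r : ℕ → ℕ} {t : ℕ → ℝ}

/-- Serves twice: for `r n` with exponent `t n`, and for `n` with exponent `log₂ n`. -/
theorem clog_le_add_one {r : ℕ} {t : ℝ} (hr : (r : ℝ) = (2 : ℝ) ^ t) (ht : 0 ≤ t) :
    (Nat.clog 2 r : ℝ) ≤ t + 1 := by
  rcases Nat.lt_or_ge 1 r with h | h
  · have h1 : (2 : ℝ) ^ ((Nat.clog 2 r - 1 : ℕ) : ℝ) < (2 : ℝ) ^ t := by
      rw [← hr, Real.rpow_natCast]
      exact_mod_cast Nat.pow_pred_clog_lt_self one_lt_two h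
    have h2 := (Real.rpow_lt_rpow_left_iff one_lt_two).1 h1
    have h3 : 0 < Nat.clog 2 r := Nat.clog_pos one_lt_two h
    rw [Nat.cast_sub h3] at h2
    push_cast at h2
    linarith
  · rw [Nat.clog_of_right_le_one h]
    push_cast
    linarith

/-- Absorbs the `1` lost in rounding `t n` up to an integer. -/
theorem isLittleO_one_div_log :
    (fun _ : ℕ => (1 : ℝ)) =o[atTop] fun n : ℕ => (n : ℝ) / Real.log n := by
  have h1 : (fun n : ℕ => Real.log n) =o[atTop] fun n : ℕ => (n : ℝ) :=
    Real.isLittleO_log_id_atTop.comp_tendsto tendsto_natCast_atTop_atTop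
  have h2 := h1.mul_isBigO (isBigO_refl (fun n : ℕ => (Real.log n)⁻¹) atTop)
  refine h2.congr' ?_ (Eventually.of_forall fun n => (div_eq_mul_inv _ _).symm)
  filter_upwards [eventually_ge_atTop 2] with n hn
  exact mul_inv_cancel₀ (Real.log_pos (by exact_mod_cast hn)).ne'

theorem isLittleO_clog (ht : t =o[atTop] fun n : ℕ => (n : ℝ) / Real.log n)
    (hr : ∀ n, (r n : ℝ) = (2 : ℝ) ^ t n) :
    (fun n => (Nat.clog 2 (r n) : ℝ)) =o[atTop] fun n : ℕ => (n : ℝ) / Real.log n := by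
  refine (IsBigO.of_norm_le fun n => ?_).trans_isLittleO (ht.add isLittleO_one_div_log)
  have h0 : 0 ≤ t n := by
    have h1 : (1 : ℝ) ≤ r n := by
      have : (0 : ℝ) < r n := by rw [hr]; positivity
      exact_mod_cast this
    rw [hr n] at h1
    by_contra! hneg
    exact absurd h1 (not_le.2 (Real.rpow_lt_one_of_one_lt_of_neg one_lt_two hneg))
  rw [Real.norm_of_nonneg (Nat.cast_nonneg _)]
  exact clog_le_add_one (hr n) h0

theorem isBigO_clog_log : (fun n : ℕ => (Nat.clog 2 n : ℝ)) =O[atTop] fun n : ℕ => Real.log n := by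
  refine IsBigO.of_bound (2 / Real.log 2) ?_
  filter_upwards [eventually_ge_atTop 2] with n hn
  have hl : 0 < Real.log 2 := Real.log_pos one_lt_two
  have hn' : (2 : ℝ) ≤ n := by exact_mod_cast hn
  have hln : Real.log 2 ≤ Real.log n := Real.log_le_log two_pos hn'
  have hpow : (n : ℝ) = (2 : ℝ) ^ (Real.log n / Real.log 2) := by
    rw [Real.rpow_def_of_pos two_pos, mul_div_cancel₀ _ hl.ne', Real.exp_log (by linarith)]
  have h := clog_le_add_one hpow (by positivity)
  rw [Real.norm_of_nonneg (Nat.cast_nonneg _), Real.norm_of_nonneg (hl.le.trans hln)]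
  calc _ ≤ _ := h
    _ = (Real.log n + Real.log 2) / Real.log 2 := by field_simp
    _ ≤ (Real.log n + Real.log n) / Real.log 2 := by gcongr
    _ = _ := by ring

theorem isLittleO_clog_mul_clog (ht : t =o[atTop] fun n : ℕ => (n : ℝ) / Real.log n)
    (hr : ∀ n, (r n : ℝ) = (2 : ℝ) ^ t n) :
    (fun n => (Nat.clog 2 n : ℝ) * (Nat.clog 2 (r n) : ℝ)) =o[atTop] fun n : ℕ => (n : ℝ) := by
  refine (isBigO_clog_log.mul_isLittleO (isLittleO_clog ht hr)).congr' EventuallyEq.rfl ?_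
  filter_upwards [eventually_ge_atTop 2] with n hn
  exact mul_div_cancel₀ _ (Real.log_pos (by exact_mod_cast hn)).ne'

theorem two_pow_clog_le {n : ℕ} (hn : 1 ≤ n) : 2 ^ Nat.clog 2 n ≤ 2 * n := by
  rcases hn.eq_or_lt with rfl | h
  · simp
  · have h1 := Nat.pow_pred_clog_lt_self one_lt_two h
    have h2 := Nat.clog_pos one_lt_two h
    calc 2 ^ Nat.clog 2 n = 2 * 2 ^ (Nat.clog 2 n).pred := by
          rw [← pow_succ', Nat.pred_eq_sub_one, Nat.sub_add_cancel h2]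
      _ ≤ 2 * n := by gcongr

/-- The relative cost of everything but the multiplexed rotations. -/
noncomputable def overhead (T k n : ℕ) : ℝ :=
  T * 2 ^ T * ((n + 2) * 2 ^ (2 * k + 4)) * 2 ^ (k * T) / 2 ^ n

/-- Half of the exponent `n` pays for `2 ^ (T + k * T)`; the rest is polynomial in `n`, with `128 =
2 * 4 * 16` from `n + 2 ≤ 2 * n` and `2 ^ (2 * k + 4) ≤ (2 * n) ^ 2 * 16`. -/
theorem overhead_le {T k n : ℕ} (hn : 2 ≤ n) (hk : 2 ^ k ≤ 2 * n) (hT : T ≤ n)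
    (h : 2 * (T + k * T) ≤ n) : overhead T k n ≤ 128 * ((n : ℝ) ^ 4 * (√2)⁻¹ ^ n) := by
  have h2 : √2 ^ 2 = (2 : ℝ) := Real.sq_sqrt zero_le_two
  have h1 : (1 : ℝ) ≤ √2 := by rw [Real.one_le_sqrt]; norm_num
  have e1 : (2 : ℝ) ^ T * 2 ^ (k * T) ≤ √2 ^ n := by
    rw [← pow_add]
    nth_rw 1 [← h2]
    rw [← pow_mul]
    exact pow_le_pow_right₀ h1 h
  have e2 : (2 : ℝ) ^ (2 * k + 4) ≤ (2 * n) ^ 2 * 16 := by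
    rw [pow_add, mul_comm 2 k, pow_mul]
    have : (2 : ℝ) ^ k ≤ 2 * n := by exact_mod_cast hk
    norm_num
    gcongr
  have e3 : (n : ℝ) + 2 ≤ 2 * n := by
    have : (2 : ℝ) ≤ n := by exact_mod_cast hn
    linarith
  have e4 : (T : ℝ) ≤ n := by exact_mod_cast hT
  have e5 : (2 : ℝ) ^ n = √2 ^ n * √2 ^ n := by rw [← mul_pow, ← pow_two, h2]
  have hpos : (0 : ℝ) < √2 ^ n := by positivity
  unfold overhead
  calc _ = T * ((n + 2) * 2 ^ (2 * k + 4)) * ((2 : ℝ) ^ T * 2 ^ (k * T)) / 2 ^ n := by ring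
    _ ≤ n * ((2 * n) * ((2 * n) ^ 2 * 16)) * √2 ^ n / 2 ^ n := by gcongr
    _ = _ := by
      rw [e5, inv_pow]
      field_simp
      ring

theorem tendsto_overhead (ht : t =o[atTop] fun n : ℕ => (n : ℝ) / Real.log n)
    (hr : ∀ n, (r n : ℝ) = (2 : ℝ) ^ t n) :
    (∀ᶠ n in atTop, Nat.clog 2 n * Nat.clog 2 (r n) ≤ n) ∧
    Tendsto (fun n : ℕ => (Nat.clog 2 (r n) : ℝ) / 2 ^ Nat.clog 2 n) atTop (𝓝 0) ∧
    Tendsto (fun n : ℕ => overhead (Nat.clog 2 (r n)) (Nat.clog 2 n) n) atTop (𝓝 0) := by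
  have hkT := isLittleO_clog_mul_clog ht hr
  have hTn : (fun n => (Nat.clog 2 (r n) : ℝ)) =o[atTop] fun n : ℕ => (n : ℝ) := by
    refine IsBigO.trans_isLittleO (IsBigO.of_bound 1 ?_) hkT
    filter_upwards [eventually_ge_atTop 2] with n hn
    have hk : (1 : ℝ) ≤ Nat.clog 2 n := by exact_mod_cast Nat.clog_pos one_lt_two hn
    rw [one_mul, norm_mul]
    exact le_mul_of_one_le_left (norm_nonneg _) (hk.trans (Real.le_norm_self _))
  -- The factors `4` combine to `2 * (T + k * T) ≤ n`, as `overhead_le` requires.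
  have hev : ∀ᶠ n in atTop, 4 * (Nat.clog 2 n * Nat.clog 2 (r n)) ≤ n ∧
      4 * Nat.clog 2 (r n) ≤ n := by
    filter_upwards [hkT.bound (show (0 : ℝ) < 1 / 4 by norm_num),
      hTn.bound (show (0 : ℝ) < 1 / 4 by norm_num)] with n h1 h2
    rw [Real.norm_of_nonneg (by positivity), Real.norm_of_nonneg (by positivity)] at h1 h2
    constructor
    · have : (4 : ℝ) * (Nat.clog 2 n * Nat.clog 2 (r n)) ≤ n := by linarith
      exact_mod_cast this
    · have : (4 : ℝ) * Nat.clog 2 (r n) ≤ n := by linarith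
      exact_mod_cast this
  refine ⟨hev.mono fun n h => by omega, ?_, ?_⟩
  · refine squeeze_zero' (Eventually.of_forall fun n => by positivity) ?_
      hTn.tendsto_div_nhds_zero
    filter_upwards [eventually_ge_atTop 1] with n hn
    have h1 : (n : ℝ) ≤ 2 ^ Nat.clog 2 n := by exact_mod_cast Nat.le_pow_clog one_lt_two n
    have h2 : (0 : ℝ) < n := by exact_mod_cast hn
    gcongr
  · refine squeeze_zero' (g := fun n : ℕ => 128 * ((n : ℝ) ^ 4 * (√2)⁻¹ ^ n))
      (Eventually.of_forall fun n => by unfold overhead; positivity) ?_ ?_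
    · filter_upwards [hev, eventually_ge_atTop 2] with n h hn
      exact overhead_le hn (two_pow_clog_le (by omega)) (by omega) (by omega)
    · have h1 : |(√2)⁻¹| < (1 : ℝ) := by
        rw [abs_of_nonneg (by positivity)]
        exact inv_lt_one_of_one_lt₀ (by rw [Real.lt_sqrt] <;> norm_num)
      simpa using (tendsto_pow_const_mul_const_pow_of_abs_lt_one 4 h1).const_mul 128

/-- Factor `(2 ^ k + 1) ^ T = 2 ^ (k * T) * (1 + 2 ^ (-k)) ^ T` and use `1 + x ≤ exp x`. -/
theorem cost_le {T k n : ℕ} (h : k * T ≤ n) :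
    (((2 ^ k + 1) ^ T * (2 ^ (n - k * T) + T * 2 ^ T * ((n + 2) * 2 ^ (2 * k + 4))) : ℕ) : ℝ) ≤
      Real.exp (T / 2 ^ k) * (1 + overhead T k n) * 2 ^ n := by
  have h1 : ((2 : ℝ) ^ k + 1) ^ T = (1 / 2 ^ k + 1) ^ T * 2 ^ (k * T) := by
    rw [pow_mul, ← mul_pow]
    congr 1
    field_simp
    ring
  have h2 : ((1 : ℝ) / 2 ^ k + 1) ^ T ≤ Real.exp (T / 2 ^ k) := by
    rw [div_eq_mul_one_div (T : ℝ), Real.exp_nat_mul]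
    gcongr
    exact Real.add_one_le_exp _
  have h3 : (2 : ℝ) ^ n = 2 ^ (k * T) * 2 ^ (n - k * T) := by
    rw [← pow_add, Nat.add_sub_cancel' h]
  have h4 : overhead T k n * 2 ^ n = T * 2 ^ T * ((n + 2) * 2 ^ (2 * k + 4)) * 2 ^ (k * T) :=
    div_mul_cancel₀ _ (by positivity)
  push_cast
  rw [mul_assoc (Real.exp _), add_mul 1, h4, one_mul, h3, h1]
  calc _ = (1 / 2 ^ k + 1) ^ T * ((2 : ℝ) ^ (k * T) * 2 ^ (n - k * T) +
        T * 2 ^ T * ((n + 2) * 2 ^ (2 * k + 4)) * 2 ^ (k * T)) := by ring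
    _ ≤ _ := by gcongr

end Asymptotic

end QCirc

theorem mainTheorem3 (r : ℕ → ℕ) (t : ℕ → ℝ)
    (ht : t =o[atTop] fun n : ℕ => (n : ℝ) / Real.log n)
    (hr : ∀ n, (r n : ℝ) = (2 : ℝ) ^ t n) :
    ∃ ε : ℕ → ℝ, Tendsto ε atTop (𝓝 0) ∧
      ∀ (n : ℕ) (f : QCirc.Bits (Fin n) → Circle),
        ∃ (a : ℕ) (C : QCirc.Circuit ((Fin (r n) × Fin (n + 1)) ⊕ Fin a)),
          C.Implements (QCirc.tensorPow (r n) (QCirc.diagOp (QCirc.bar f))) ∧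
          (C.cnotCount : ℝ) ≤ (1 + ε n) * (2 : ℝ) ^ n := by
  obtain ⟨hev, hexp, hover⟩ := QCirc.tendsto_overhead ht hr
  -- The recursion needs `k * T ≤ n`, which fails for only finitely many `n`; there the direct
  -- circuit with `r n * 2 ^ n` CNOTs is used, whence `r n - 1`.
  refine ⟨fun n => if Nat.clog 2 n * Nat.clog 2 (r n) ≤ n then
    Real.exp (Nat.clog 2 (r n) / 2 ^ Nat.clog 2 n) *
      (1 + QCirc.overhead (Nat.clog 2 (r n)) (Nat.clog 2 n) n) - 1 else r n - 1, ?_, ?_⟩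
  · have h := (((Real.continuous_exp.tendsto 0).comp hexp).mul (hover.const_add 1)).sub_const 1
    rw [Real.exp_zero, add_zero, mul_one, sub_self] at h
    refine h.congr' (hev.mono fun n hn => ?_)
    simp only [if_pos hn, Function.comp_apply]
  · intro n f
    have hpos : 0 < r n := by
      have : (0 : ℝ) < r n := by rw [hr]; positivity
      exact_mod_cast this
    by_cases h : Nat.clog 2 n * Nat.clog 2 (r n) ≤ n
    · obtain ⟨a, C, hC, hcost⟩ := (QCirc.massProduces_clog hpos h).exists_circuit f
      refine ⟨a, C, hC, (Nat.cast_le.2 hcost).trans ((QCirc.cost_le h).trans_eq ?_)⟩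
      simp only [if_pos h]
      ring
    · obtain ⟨a, C, hC, hcost⟩ :=
        (QCirc.massProduces_direct (Fin (r n)) (Fin n)).exists_circuit f
      refine ⟨a, C, hC, (Nat.cast_le.2 hcost).trans_eq ?_⟩
      simp only [if_neg h, Fintype.card_fin]
      push_cast
      ring
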